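/- Let $0<R\le\infty$, $I=(0,R)$, and let $f:I\to\mathbb{R}$ be an arbitrary function (no continuity or differentiability is assumed). For a real matrix $A=(a_{ij})$ with entries in $I$ write $f[A]:=(f(a_{ij}))$, and let $\mathbf 1_{n\times n}$ be the $n\times n$ matrix with all entries equal to $1$. Then the following are equivalent: (1) For every $n\ge 1$, every $a\in[0,R)$ and every $u\in\mathbb{R}^n$ such that $a+u_iu_j\in I$ for all $i,j$, the matrix $f[a\mathbf 1_{n\times n}+uu^T]$ is positive semidefinite. (2) For every $n\ge 1$ and every real symmetric positive semidefinite $n\times n$ matrix $A$ with entries in $I$, the matrix $f[A]$ is positive semidefinite. (3) $f$ is absolutely monotonic on $I$, that is, $f$ is continuous on $I$, infinitely differentiable on $I$, and $f^{(k)}(x)\ge 0$ for all $x\in I$ and all integers $k\ge 0$. -/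

import Mathlib

open scoped ContDiff Matrix

/-- The open interval `(0, R)` of real numbers, where `0 < R ≤ ∞`. -/
def intervalZeroTo (R : EReal) : Set ℝ :=
  {x : ℝ | 0 < x ∧ (x : EReal) < R}

/-- The real symmetric positive semidefinite `n × n` matrices with all entries in `I`. -/
def psdMatrices (n : ℕ) (I : Set ℝ) : Set (Matrix (Fin n) (Fin n) ℝ) :=
  {A | A.PosSemidef ∧ ∀ i j, A i j ∈ I}

/-- The matrix `a 1ₙₓₙ + u uᵀ`, where `1ₙₓₙ` is the all-ones matrix; its `(i, j)` entry is
`a + uᵢ uⱼ`. -/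
def specialMatrix {n : ℕ} (a : ℝ) (u : Fin n → ℝ) : Matrix (Fin n) (Fin n) ℝ :=
  a • (Matrix.of fun _ _ => 1) + Matrix.vecMulVec u u

/-- `f` is absolutely monotonic on the interval `I`: it is continuous on `I`, smooth on the
interior of `I`, and all its derivatives (of order `k ≥ 0`) are nonnegative there. -/
def IsAbsolutelyMonotonicOn (f : ℝ → ℝ) (I : Set ℝ) : Prop :=
  ContinuousOn f I ∧ ContDiffOn ℝ ∞ f (interior I) ∧
    ∀ k : ℕ, ∀ x ∈ interior I, 0 ≤ iteratedDeriv k f x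

/-!
The implication (2) ⇒ (1) holds because `a 1 + u uᵀ` is positive semidefinite for `a ≥ 0`.

(3) ⇒ (2). By Bernstein's theorem (`IsDerivTower.tendsto_taylor`) an absolutely monotonic function
is the sum of its Taylor series to the right of any centre `ε > 0`. Hence `f(ε + Aᵢⱼ)` is a limit of
combinations, with nonnegative coefficients, of entrywise powers of `A`, which are positive
semidefinite by the Schur product theorem; continuity of `f` lets `ε → 0`. Convergence of the series
follows from an elementary estimate: the `n`-th remainder is `t ^ n` times a nondecreasing function
of the increment `t`, so it is at most `(x / b) ^ n` times a constant for `0 ≤ x < b`.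

(1) ⇒ (3). The `2 × 2` matrices in (1) show that `f` is nonnegative, nondecreasing and
multiplicatively midpoint convex, hence continuous (`PreservesSpecial.continuousOn`). Condition (1)
is stable under averaging small translates of `f`, so it passes, near a given point, to
mollifications of `f`. For a smooth function `G` Loewner's argument applies: if
`∑ cᵢ uᵢ ^ m = 0` for all `m < k`, then
`∑ cᵢ cⱼ G(x + t uᵢ uⱼ) = G⁽ᵏ⁾(x) / k! * (∑ cᵢ uᵢ ^ k)² * t ^ k + o(t ^ k)`, and nonnegativity of the
left side gives `G⁽ᵏ⁾(x) ≥ 0` (`iteratedDeriv_nonneg_of_sum_nonneg`). So `f` is locally a pointwise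
limit of absolutely monotonic functions. Such limits are again absolutely monotonic
(`IsDerivTower.exists_of_tendsto`): all the derivatives are locally bounded, so that limits of the
`k`-th derivatives along an ultrafilter exist, and the quadratic bound on the first-order Taylor
remainder survives in the limit.
-/

/-! ### Towers of nonnegative derivatives -/

/-- A tower of nonnegative derivatives on `J`: each `g k` is nonnegative on `J` and has derivative
`g (k + 1)` there. A function on an open set is absolutely monotonic exactly when it is the bottom
`g 0` of such a tower; carrying all the derivatives as explicit data makes shifting (pass from
`g 0` to `g 1`) and passing to the limit immediate. -/
def IsDerivTower (g : ℕ → ℝ → ℝ) (J : Set ℝ) : Prop :=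
  ∀ k, ∀ x ∈ J, HasDerivAt (g k) (g (k + 1) x) x ∧ 0 ≤ g k x

namespace IsDerivTower

open Set Filter Topology

variable {g : ℕ → ℝ → ℝ} {J : Set ℝ}

lemma shift (h : IsDerivTower g J) (m : ℕ) : IsDerivTower (fun k => g (k + m)) J := by
  intro k x hx
  have := h (k + m) x hx
  rw [add_right_comm] at this
  exact this

lemma monotoneOn (h : IsDerivTower g J) (hJ : Convex ℝ J) (k : ℕ) : MonotoneOn (g k) J := by
  refine monotoneOn_of_deriv_nonneg hJ (fun x hx => (h k x hx).1.continuousAt.continuousWithinAt)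
    (fun x hx => ((h k x (interior_subset hx)).1.differentiableAt).differentiableWithinAt)
    fun x hx => ?_
  rw [(h k x (interior_subset hx)).1.deriv]
  exact (h (k + 1) x (interior_subset hx)).2

lemma contDiffOn (h : IsDerivTower g J) (hJ : IsOpen J) (n k : ℕ) : ContDiffOn ℝ n (g k) J := by
  induction n generalizing k with
  | zero =>
    rw [Nat.cast_zero, contDiffOn_zero]
    exact fun x hx => (h k x hx).1.continuousAt.continuousWithinAt
  | succ n ih =>
    rw [Nat.cast_succ, contDiffOn_succ_iff_deriv_of_isOpen hJ]
    exact ⟨fun x hx => (h k x hx).1.differentiableAt.differentiableWithinAt, by simp,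
      (ih (k + 1)).congr fun x hx => (h k x hx).1.deriv⟩

lemma iteratedDeriv_eq (h : IsDerivTower g J) (hJ : IsOpen J) (k : ℕ) :
    EqOn (iteratedDeriv k (g 0)) (g k) J := by
  induction k with
  | zero => intro x _; simp
  | succ k ih =>
    intro x hx
    rw [iteratedDeriv_succ, (ih.eventuallyEq_of_mem (hJ.mem_nhds hx)).deriv_eq, (h k x hx).1.deriv]

/-- The derivatives of a smooth function form a tower as soon as they are nonnegative. -/
lemma of_contDiffOn {f : ℝ → ℝ} (hJ : IsOpen J) (hf : ContDiffOn ℝ ∞ f J)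
    (hnn : ∀ k : ℕ, ∀ x ∈ J, 0 ≤ iteratedDeriv k f x) :
    IsDerivTower (fun k => iteratedDeriv k f) J := by
  refine fun k x hx => ⟨?_, hnn k x hx⟩
  beta_reduce
  rw [iteratedDeriv_succ, hasDerivAt_deriv_iff]
  have hd := hf.differentiableOn_iteratedDerivWithin (m := k)
    (by exact_mod_cast WithTop.coe_lt_top k) hJ.uniqueDiffOn
  exact (hd.congr fun y hy => (iteratedDerivWithin_of_isOpen hJ hy).symm).differentiableAt
    (hJ.mem_nhds hx)

/-! ### Convergence of Taylor series -/

/-- The remainder after `n` terms of the Taylor series at `c`, as a function of the increment. -/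
noncomputable def taylorRemainder (g : ℕ → ℝ → ℝ) (c : ℝ) (n : ℕ) (t : ℝ) : ℝ :=
  g 0 (c + t) - ∑ k ∈ Finset.range n, g k c / k.factorial * t ^ k

lemma hasDerivAt_taylorRemainder_succ {c t : ℝ} (h : IsDerivTower g J) (ht : c + t ∈ J) (n : ℕ) :
    HasDerivAt (taylorRemainder g c (n + 1)) (taylorRemainder (fun k => g (k + 1)) c n t) t := by
  have h1 : HasDerivAt (fun s => g 0 (c + s)) (g 1 (c + t)) t := (h 0 _ ht).1.comp_const_add c t
  have h2 : HasDerivAt (fun s : ℝ => ∑ k ∈ Finset.range (n + 1), g k c / k.factorial * s ^ k)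
      (∑ k ∈ Finset.range (n + 1), g k c / k.factorial * (k * t ^ (k - 1))) t :=
    HasDerivAt.fun_sum fun k _ => (hasDerivAt_pow k t).const_mul _
  refine (h1.sub h2).congr_deriv ?_
  unfold taylorRemainder
  rw [Finset.sum_range_succ']
  simp only [Nat.cast_zero, zero_mul, mul_zero, add_zero, Nat.add_sub_cancel, Nat.factorial_succ]
  congr 1
  refine Finset.sum_congr rfl fun k _ => ?_
  have : (k.factorial : ℝ) ≠ 0 := by positivity
  push_cast
  field_simp

lemma taylorRemainder_succ_zero (g : ℕ → ℝ → ℝ) (c : ℝ) (n : ℕ) :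
    taylorRemainder g c (n + 1) 0 = 0 := by
  simp [taylorRemainder, Finset.sum_range_succ']

lemma taylorRemainder_nonneg {c b : ℝ} (h : IsDerivTower g J) (hJ : ∀ t ∈ Icc 0 b, c + t ∈ J)
    (n : ℕ) : ∀ t ∈ Icc 0 b, 0 ≤ taylorRemainder g c n t := by
  induction n generalizing g with
  | zero => intro t ht; simpa [taylorRemainder] using (h 0 _ (hJ t ht)).2
  | succ n ih =>
    intro t ht
    have hd := fun s hs => h.hasDerivAt_taylorRemainder_succ (hJ s hs) n
    have hmono : MonotoneOn (taylorRemainder g c (n + 1)) (Icc 0 b) := by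
      refine monotoneOn_of_deriv_nonneg (convex_Icc 0 b)
        (fun s hs => (hd s hs).continuousAt.continuousWithinAt)
        (fun s hs => (hd s (interior_subset hs)).differentiableAt.differentiableWithinAt)
        fun s hs => ?_
      rw [(hd s (interior_subset hs)).deriv]
      exact ih (h.shift 1) s (interior_subset hs)
    rw [← taylorRemainder_succ_zero g c n]
    exact hmono ⟨le_rfl, ht.1.trans ht.2⟩ ht ht.1

/-- The remainder is `t ^ n` times a nondecreasing function of `t`, stated multiplicatively. -/
lemma taylorRemainder_mul_le {c b l : ℝ} (h : IsDerivTower g J) (hb : ∀ t ∈ Icc 0 b, c + t ∈ J)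
    (hJ : Convex ℝ J) (hl : l ∈ Icc (0 : ℝ) 1) (n : ℕ) :
    ∀ t ∈ Icc 0 b, taylorRemainder g c n (l * t) ≤ l ^ n * taylorRemainder g c n t := by
  have hlt : ∀ t ∈ Icc 0 b, l * t ∈ Icc 0 b := fun t ht =>
    ⟨mul_nonneg hl.1 ht.1, (mul_le_of_le_one_left ht.1 hl.2).trans ht.2⟩
  induction n generalizing g with
  | zero =>
    intro t ht
    simpa [taylorRemainder] using h.monotoneOn hJ 0 (hb _ (hlt t ht)) (hb t ht)
      (by linarith [mul_le_of_le_one_left ht.1 hl.2])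
  | succ n ih =>
    intro t ht
    have hd : ∀ s ∈ Icc 0 b, HasDerivAt
        (fun s => l ^ (n + 1) * taylorRemainder g c (n + 1) s - taylorRemainder g c (n + 1) (l * s))
        (l ^ (n + 1) * taylorRemainder (fun k => g (k + 1)) c n s -
          taylorRemainder (fun k => g (k + 1)) c n (l * s) * l) s := fun s hs => by
      have h1 := h.hasDerivAt_taylorRemainder_succ (hb _ (hlt s hs)) n
      have h2 : HasDerivAt (fun s => l * s) l s := by simpa using (hasDerivAt_id s).const_mul l
      exact ((h.hasDerivAt_taylorRemainder_succ (hb s hs) n).const_mul _).sub (h1.comp s h2)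
    have hmono : MonotoneOn (fun s => l ^ (n + 1) * taylorRemainder g c (n + 1) s -
        taylorRemainder g c (n + 1) (l * s)) (Icc 0 b) := by
      refine monotoneOn_of_deriv_nonneg (convex_Icc 0 b)
        (fun s hs => (hd s hs).continuousAt.continuousWithinAt)
        (fun s hs => (hd s (interior_subset hs)).differentiableAt.differentiableWithinAt)
        fun s hs => ?_
      rw [(hd s (interior_subset hs)).deriv, pow_succ]
      nlinarith [ih (h.shift 1) s (interior_subset hs), hl.1]
    have := hmono ⟨le_rfl, ht.1.trans ht.2⟩ ht ht.1
    simp only [mul_zero, taylorRemainder_succ_zero, sub_zero] at this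
    linarith

/-- **Bernstein's theorem**: an absolutely monotonic function is the sum of its Taylor series to
the right of any centre. -/
theorem tendsto_taylor {c b x : ℝ} (h : IsDerivTower g J) (hb : ∀ t ∈ Icc 0 b, c + t ∈ J)
    (hJ : Convex ℝ J) (hx : 0 ≤ x) (hxb : x < b) :
    Tendsto (fun n => ∑ k ∈ Finset.range n, g k c / k.factorial * x ^ k) atTop
      (𝓝 (g 0 (c + x))) := by
  have hb0 : 0 < b := hx.trans_lt hxb
  have hl : x / b ∈ Icc (0 : ℝ) 1 := ⟨by positivity, (div_le_one hb0).2 hxb.le⟩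
  have hbb : b ∈ Icc 0 b := ⟨hb0.le, le_rfl⟩
  have hc : c ∈ J := by simpa using hb 0 ⟨le_rfl, hb0.le⟩
  have hR : Tendsto (fun n => taylorRemainder g c n x) atTop (𝓝 0) := by
    have hpow : Tendsto (fun n : ℕ => (x / b) ^ n * g 0 (c + b)) atTop (𝓝 0) := by
      simpa using (tendsto_pow_atTop_nhds_zero_of_lt_one hl.1
        ((div_lt_one hb0).2 hxb)).mul_const (g 0 (c + b))
    refine squeeze_zero (fun n => h.taylorRemainder_nonneg hb n x ⟨hx, hxb.le⟩) (fun n => ?_) hpow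
    have h1 := h.taylorRemainder_mul_le hb hJ hl n b hbb
    rw [div_mul_cancel₀ x hb0.ne'] at h1
    refine h1.trans (mul_le_mul_of_nonneg_left ?_ (pow_nonneg hl.1 n))
    exact sub_le_self _ (Finset.sum_nonneg fun k _ =>
      mul_nonneg (div_nonneg (h k c hc).2 (by positivity)) (by positivity))
  simpa [taylorRemainder] using hR.const_sub (g 0 (c + x))

/-! ### Pointwise limits of absolutely monotonic functions -/

/-- A pointwise bound on the bottoms of a family of towers bounds every level pointwise, since
`g (k + 1) x` is at most the slope of `g k` between `x` and a point to its right. -/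
lemma exists_bound {ι : Type*} {G : ι → ℕ → ℝ → ℝ} (h : ∀ i, IsDerivTower (G i) J)
    (hJ : Convex ℝ J) (hJo : IsOpen J) (hbd : ∀ x ∈ J, ∃ M, ∀ i, G i 0 x ≤ M) (k : ℕ) :
    ∀ x ∈ J, ∃ M, ∀ i, G i k x ≤ M := by
  induction k with
  | zero => exact hbd
  | succ k ih =>
    intro x hx
    obtain ⟨ε, hε, hball⟩ := Metric.isOpen_iff.1 hJo x hx
    have hy : x + ε / 2 ∈ J := hball (by
      rw [Metric.mem_ball, Real.dist_eq, add_sub_cancel_left, abs_of_pos (by positivity)]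
      linarith)
    obtain ⟨M, hM⟩ := ih _ hy
    refine ⟨M / (ε / 2), fun i => ?_⟩
    have hsub : Icc x (x + ε / 2) ⊆ J := hJ.ordConnected.out hx hy
    obtain ⟨ξ, hξ, hs⟩ := exists_hasDerivAt_eq_slope (G i k) (G i (k + 1))
      (by linarith : x < x + ε / 2)
      (fun z hz => (h i k z (hsub hz)).1.continuousAt.continuousWithinAt)
      (fun z hz => (h i k z (hsub (Ioo_subset_Icc_self hz))).1)
    have h1 := (h i).monotoneOn hJ (k + 1) hx (hsub (Ioo_subset_Icc_self hξ)) hξ.1.le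
    rw [hs, add_sub_cancel_left] at h1
    refine h1.trans ?_
    gcongr
    linarith [hM i, (h i k x hx).2]

/-- First-order Taylor estimate: the second derivative is nondecreasing, so on `[x - r, x + r]` it is
bounded by its value at the right end. -/
lemma abs_sub_sub_le {x y r M : ℝ} (h : IsDerivTower g J) (hJ : Convex ℝ J) (k : ℕ)
    (hr : ∀ z, |z - x| ≤ r → z ∈ J) (hM : g (k + 2) (x + r) ≤ M) (hy : |y - x| ≤ r) :
    |g k y - g k x - g (k + 1) x * (y - x)| ≤ M * |y - x| * |y - x| := by
  have hr0 : 0 ≤ r := (abs_nonneg _).trans hy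
  have hseg : ∀ z ∈ uIcc x y, |z - x| ≤ |y - x| := fun z hz =>
    abs_sub_left_of_mem_uIcc hz
  have hmem : ∀ z ∈ uIcc x y, z ∈ J := fun z hz => hr z ((hseg z hz).trans hy)
  have hsec : ∀ z ∈ uIcc x y, ‖g (k + 2) z‖ ≤ M := fun z hz => by
    rw [Real.norm_of_nonneg (h _ z (hmem z hz)).2]
    refine le_trans (h.monotoneOn hJ (k + 2) (hmem z hz) (hr _ ?_) ?_) hM
    · rw [add_sub_cancel_left, abs_of_nonneg hr0]
    · linarith [(le_abs_self _).trans ((hseg z hz).trans hy)]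
  have hM0 : 0 ≤ M := (norm_nonneg _).trans (hsec x left_mem_uIcc)
  have hfirst : ∀ z ∈ uIcc x y, ‖g (k + 1) z - g (k + 1) x‖ ≤ M * |y - x| := fun z hz => by
    have := (convex_uIcc x y).norm_image_sub_le_of_norm_hasDerivWithin_le
      (fun w hw => (h (k + 1) w (hmem w hw)).1.hasDerivWithinAt) hsec left_mem_uIcc hz
    exact this.trans (mul_le_mul_of_nonneg_left (hseg z hz) hM0)
  have := (convex_uIcc x y).norm_image_sub_le_of_norm_hasDerivWithin_le
    (f := fun z => g k z - g (k + 1) x * z) (f' := fun z => g (k + 1) z - g (k + 1) x)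
    (fun w hw => ((h k w (hmem w hw)).1.sub
      (by simpa using (hasDerivAt_id w).const_mul (g (k + 1) x))).hasDerivWithinAt)
    hfirst left_mem_uIcc right_mem_uIcc
  rw [Real.norm_eq_abs, Real.norm_eq_abs] at this
  convert this using 2
  ring

/-- A pointwise limit of absolutely monotonic functions is absolutely monotonic. The higher levels
of the limiting tower are limits along a nonprincipal ultrafilter, which exist by boundedness. -/
theorem exists_of_tendsto {G : ℕ → ℕ → ℝ → ℝ} {f : ℝ → ℝ} (h : ∀ i, IsDerivTower (G i) J)
    (hJ : Convex ℝ J) (hJo : IsOpen J)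
    (hf : ∀ x ∈ J, Tendsto (fun i => G i 0 x) atTop (𝓝 (f x))) :
    ∃ g, IsDerivTower g J ∧ EqOn (g 0) f J := by
  have hbd := exists_bound h hJ hJo fun x hx => by
    obtain ⟨M, hM⟩ := (hf x hx).bddAbove_range
    exact ⟨M, fun i => hM (mem_range_self i)⟩
  have hlim : ∀ k x, ∃ L, x ∈ J → Tendsto (fun i => G i k x) (hyperfilter ℕ : Filter ℕ) (𝓝 L) := by
    intro k x
    by_cases hx : x ∈ J
    · obtain ⟨M, hM⟩ := hbd k x hx
      obtain ⟨L, -, hL⟩ := (isCompact_Icc (a := 0) (b := M)).ultrafilter_le_nhds'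
        ((hyperfilter ℕ).map fun i => G i k x)
        (Ultrafilter.mem_map.2 (univ_mem' fun i => ⟨(h i k x hx).2, hM i⟩))
      exact ⟨L, fun _ => hL⟩
    · exact ⟨0, fun hx' => absurd hx' hx⟩
  choose g hg using hlim
  refine ⟨g, fun k x hx => ⟨?_, ?_⟩, fun x hx => ?_⟩
  · obtain ⟨ε, hε, hball⟩ := Metric.isOpen_iff.1 hJo x hx
    have hr : ∀ z, |z - x| ≤ ε / 2 → z ∈ J := fun z hz => hball (by
      rw [Metric.mem_ball, Real.dist_eq]; linarith)
    obtain ⟨M, hM⟩ := hbd (k + 2) (x + ε / 2) (hr _ (by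
      rw [add_sub_cancel_left, abs_of_pos (by positivity)]))
    have hquad : ∀ y, |y - x| ≤ ε / 2 →
        |g k y - g k x - g (k + 1) x * (y - x)| ≤ M * |y - x| * |y - x| := fun y hy =>
      le_of_tendsto ((((hg k y (hr y hy)).sub (hg k x hx)).sub
        ((hg (k + 1) x hx).mul_const (y - x))).abs)
        (Eventually.of_forall fun i => (h i).abs_sub_sub_le hJ k hr (hM i) hy)
    rw [hasDerivAt_iff_isLittleO]
    have hO : (fun y => g k y - g k x - (y - x) • g (k + 1) x) =O[𝓝 x]
        fun y => ‖y - x‖ ^ 2 := by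
      refine Asymptotics.IsBigO.of_bound M ?_
      filter_upwards [Metric.closedBall_mem_nhds x (half_pos hε)] with y hy
      rw [Metric.mem_closedBall, Real.dist_eq] at hy
      have := hquad y hy
      simp only [smul_eq_mul, Real.norm_eq_abs, abs_pow, abs_abs]
      rw [mul_comm (y - x), pow_two, ← mul_assoc]
      exact this
    exact hO.trans_isLittleO (Asymptotics.isLittleO_pow_sub_sub x one_lt_two)
  · exact ge_of_tendsto (hg k x hx) (Eventually.of_forall fun i => (h i k x hx).2)
  · exact tendsto_nhds_unique (hg 0 x hx) ((hf x hx).mono_left Nat.hyperfilter_le_atTop)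

end IsDerivTower

/-! ### The interval `(0, R)` -/

section Interval

variable {R : EReal}

lemma isOpen_intervalZeroTo : IsOpen (intervalZeroTo R) :=
  isOpen_Ioi.inter (isOpen_Iio.preimage continuous_coe_real_ereal)

lemma ordConnected_intervalZeroTo : (intervalZeroTo R).OrdConnected :=
  ⟨fun _ hx _ hy _ hz => ⟨hx.1.trans_le hz.1, (EReal.coe_le_coe_iff.2 hz.2).trans_lt hy.2⟩⟩

end Interval

/-! ### Entrywise powers and limits of positive semidefinite matrices -/

section QuadraticForm

variable {ι : Type*} [Fintype ι] {A : Matrix ι ι ℝ}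

lemma dotProduct_mulVec_eq_sum (x : ι → ℝ) :
    star x ⬝ᵥ (A *ᵥ x) = ∑ i, ∑ j, x i * x j * A i j := by
  simp only [dotProduct, Matrix.mulVec, Finset.mul_sum, star_trivial]
  exact Finset.sum_congr rfl fun i _ => Finset.sum_congr rfl fun j _ => by ring

lemma posSemidef_ones : (Matrix.of fun _ _ => 1 : Matrix ι ι ℝ).PosSemidef := by
  convert Matrix.posSemidef_vecMulVec_self_star (fun _ : ι => (1 : ℝ)) using 1
  ext i j
  simp [Matrix.vecMulVec_apply]

/-- The entrywise powers of a positive semidefinite matrix are positive semidefinite, by the Schur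
product theorem. -/
lemma Matrix.PosSemidef.map_pow (hA : A.PosSemidef) (k : ℕ) : (A.map (· ^ k)).PosSemidef := by
  induction k with
  | zero =>
    convert posSemidef_ones (ι := ι) using 1
    ext i j
    simp
  | succ k ih =>
    have : A.map (· ^ (k + 1)) = A.map (· ^ k) ⊙ A := by
      ext i j
      simp [pow_succ]
    rw [this]
    exact ih.hadamard hA

lemma Matrix.PosSemidef.of_tendsto {κ : Type*} {l : Filter κ} [l.NeBot] {B : κ → Matrix ι ι ℝ}
    (hB : ∀ᶠ m in l, (B m).PosSemidef)
    (hlim : ∀ i j, Filter.Tendsto (fun m => B m i j) l (nhds (A i j))) : A.PosSemidef := by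
  refine .of_dotProduct_mulVec_nonneg ?_ fun x => ?_
  · ext i j
    refine tendsto_nhds_unique_of_eventuallyEq (hlim j i) (hlim i j) (hB.mono fun m hm => ?_)
    simpa using (hm.isHermitian.apply i j)
  · rw [dotProduct_mulVec_eq_sum]
    refine ge_of_tendsto (tendsto_finsetSum _ fun i _ => tendsto_finsetSum _ fun j _ =>
      (hlim i j).const_mul (x i * x j)) (hB.mono fun m hm => ?_)
    rw [← dotProduct_mulVec_eq_sum]
    exact hm.dotProduct_mulVec_nonneg x

end QuadraticForm

/-! ### Absolutely monotonic functions preserve positivity -/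

section Preserve

open Set Filter Topology

variable {n : ℕ} {R : EReal} {f : ℝ → ℝ} {A : Matrix (Fin n) (Fin n) ℝ}

lemma exists_entry_bound (hn : 1 ≤ n) (hA : ∀ i j, A i j ∈ intervalZeroTo R) :
    ∃ b ∈ intervalZeroTo R, ∀ i j, A i j < b := by
  have : Nonempty (Fin n) := ⟨⟨0, hn⟩⟩
  obtain ⟨p, hp⟩ := Finite.exists_max fun p : Fin n × Fin n => A p.1 p.2
  obtain ⟨b, hb1, hb2⟩ := EReal.lt_iff_exists_real_btwn.1 (hA p.1 p.2).2
  have hb1 := EReal.coe_lt_coe_iff.1 hb1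
  exact ⟨b, ⟨(hA p.1 p.2).1.trans hb1, hb2⟩, fun i j => (hp (i, j)).trans_lt hb1⟩

/-- The function is expanded at a small `ε > 0`, where its Taylor series has nonnegative
coefficients, and is applied to `ε + Aᵢⱼ`, so that the powers occurring are powers of the entries
of `A` itself. -/
lemma IsAbsolutelyMonotonicOn.posSemidef_map (hf : IsAbsolutelyMonotonicOn f (intervalZeroTo R))
    (hn : 1 ≤ n) (hA : A.PosSemidef) (hAI : ∀ i j, A i j ∈ intervalZeroTo R) :
    (A.map f).PosSemidef := by
  obtain ⟨b, hbI, hb⟩ := exists_entry_bound hn hAI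
  obtain ⟨hcont, hsmooth, hnn⟩ := hf
  rw [isOpen_intervalZeroTo.interior_eq] at hsmooth hnn
  have htower := IsDerivTower.of_contDiffOn isOpen_intervalZeroTo hsmooth hnn
  have hsum : Tendsto (fun ε : ℝ => ε + b) (𝓝[>] 0) (𝓝 b) := by
    have : Tendsto (fun ε : ℝ => ε + b) (𝓝 0) (𝓝 (0 + b)) :=
      (continuous_id.add continuous_const).tendsto 0
    rw [zero_add] at this
    exact this.mono_left nhdsWithin_le_nhds
  refine .of_tendsto (l := 𝓝[>] (0 : ℝ)) (B := fun ε => A.map fun x => f (ε + x)) ?_ fun i j => ?_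
  · filter_upwards [self_mem_nhdsWithin, hsum (isOpen_intervalZeroTo.mem_nhds hbI)] with ε hε hεb
    have hmem : ∀ t ∈ Icc 0 b, ε + t ∈ intervalZeroTo R := fun t ht =>
      ⟨add_pos_of_pos_of_nonneg hε ht.1,
        (EReal.coe_le_coe_iff.2 (by linarith [ht.2])).trans_lt hεb.2⟩
    have hpartial : ∀ m, (∑ k ∈ Finset.range m,
        (iteratedDeriv k f ε / k.factorial) • A.map (· ^ k)).PosSemidef := fun m =>
      Matrix.posSemidef_sum _ fun k _ => (hA.map_pow k).smul (div_nonneg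
        (hnn k ε (by simpa using hmem 0 ⟨le_rfl, hbI.1.le⟩)) (by positivity))
    refine .of_tendsto (l := atTop) (Eventually.of_forall hpartial) fun i j => ?_
    have := htower.tendsto_taylor hmem ordConnected_intervalZeroTo.convex
      (hAI i j).1.le (hb i j)
    simpa [Matrix.sum_apply] using this
  · have h1 : Tendsto (fun ε : ℝ => ε + A i j) (𝓝[>] 0) (𝓝 (A i j)) := by
      have : Tendsto (fun ε : ℝ => ε + A i j) (𝓝 0) (𝓝 (0 + A i j)) :=
        (continuous_id.add continuous_const).tendsto 0
      rw [zero_add] at this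
      exact this.mono_left nhdsWithin_le_nhds
    exact ((hcont.continuousAt (isOpen_intervalZeroTo.mem_nhds (hAI i j))).tendsto.comp h1)

lemma posSemidef_specialMatrix {a : ℝ} (ha : 0 ≤ a) (u : Fin n → ℝ) :
    (specialMatrix a u).PosSemidef :=
  (posSemidef_ones.smul ha).add (by simpa using Matrix.posSemidef_vecMulVec_self_star u)

lemma specialMatrix_apply (a : ℝ) (u : Fin n → ℝ) (i j : Fin n) :
    specialMatrix a u i j = a + u i * u j := by
  simp [specialMatrix, Matrix.vecMulVec_apply]

end Preserve

/-! ### Monotonicity and continuity from `2 × 2` matrices -/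

/-- `f` maps the matrices `a 1 + u uᵀ` with entries in `(0, R)` to positive semidefinite matrices.
The condition `a < R` is automatic, since `a + uᵢ ^ 2 < R`. -/
def PreservesSpecial (f : ℝ → ℝ) (R : EReal) : Prop :=
  ∀ n : ℕ, 1 ≤ n → ∀ a : ℝ, 0 ≤ a → ∀ u : Fin n → ℝ,
    (∀ i j, a + u i * u j ∈ intervalZeroTo R) → ((specialMatrix a u).map f).PosSemidef

namespace PreservesSpecial

open Set Filter Topology Function

variable {f : ℝ → ℝ} {R : EReal}

lemma sum_nonneg (h : PreservesSpecial f R) {n : ℕ} (hn : 1 ≤ n) {a : ℝ} (ha : 0 ≤ a)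
    (u c : Fin n → ℝ) (hI : ∀ i j, a + u i * u j ∈ intervalZeroTo R) :
    0 ≤ ∑ i, ∑ j, c i * c j * f (a + u i * u j) := by
  have := (h n hn a ha u hI).dotProduct_mulVec_nonneg c
  rw [dotProduct_mulVec_eq_sum] at this
  simpa only [Matrix.map_apply, specialMatrix_apply] using this

lemma nonneg (h : PreservesSpecial f R) {x : ℝ} (hx : x ∈ intervalZeroTo R) : 0 ≤ f x := by
  have := h.sum_nonneg le_rfl hx.1.le (fun _ : Fin 1 => 0) (fun _ => 1) (fun i j => by simpa)
  simpa using this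

lemma sq_le (h : PreservesSpecial f R) {a v w : ℝ} (ha : 0 ≤ a)
    (hv : a + v * v ∈ intervalZeroTo R) (hvw : a + v * w ∈ intervalZeroTo R)
    (hw : a + w * w ∈ intervalZeroTo R) :
    f (a + v * w) ^ 2 ≤ f (a + v * v) * f (a + w * w) := by
  have hI : ∀ i j, a + ![v, w] i * ![v, w] j ∈ intervalZeroTo R := by
    intro i j
    fin_cases i <;> fin_cases j <;> simp [hv, hvw, hw, mul_comm w v]
  have := (h 2 one_le_two a ha ![v, w] hI).det_nonneg
  rw [Matrix.det_fin_two] at this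
  simp only [Matrix.map_apply, specialMatrix_apply, Matrix.cons_val_zero, Matrix.cons_val_one,
    mul_comm w v] at this
  linarith [sq (f (a + v * w))]

/-- The matrix with rows `(x, x)` and `(x, y)` is `x 1 + u uᵀ` with `u = (0, √(y - x))`. -/
lemma monotoneOn (h : PreservesSpecial f R) : MonotoneOn f (intervalZeroTo R) := by
  intro x hx y hy hxy
  have hs : √(y - x) * √(y - x) = y - x := Real.mul_self_sqrt (sub_nonneg.2 hxy)
  have := h.sq_le (a := x) (v := 0) (w := √(y - x)) hx.1.le (by simpa) (by simpa) (by
    rw [hs]; simpa)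
  rw [hs] at this
  simp only [mul_zero, zero_mul, add_zero, add_sub_cancel] at this
  rcases (h.nonneg hx).eq_or_lt with h0 | h0
  · rw [← h0]; exact h.nonneg hy
  · rw [sq] at this
    exact le_of_mul_le_mul_left this h0

/-- `f` is multiplicatively midpoint convex, so its one-sided limits at `p` satisfy
`f(p⁺)² ≤ f(p⁻) f(p⁺)`; for a nonnegative nondecreasing function this forces `f(p⁺) = f(p⁻)`. -/
lemma continuousOn (h : PreservesSpecial f R) : ContinuousOn f (intervalZeroTo R) := by
  intro p hp
  obtain ⟨ε, hε, hball⟩ := Metric.isOpen_iff.1 isOpen_intervalZeroTo p hp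
  have hp0 : 0 < p := hp.1
  obtain ⟨c, d, hc, hd, hcp, hpd⟩ : ∃ c d, c ∈ intervalZeroTo R ∧ d ∈ intervalZeroTo R ∧
      c < p ∧ p < d := by
    refine ⟨p - ε / 2, p + ε / 2, hball ?_, hball ?_, by linarith, by linarith⟩ <;>
    · rw [Metric.mem_ball, Real.dist_eq, abs_lt]
      constructor <;> linarith
  have hcd : ∀ {x}, x ∈ Icc c d → x ∈ intervalZeroTo R := fun hx =>
    ordConnected_intervalZeroTo.out hc hd hx
  -- The truncation of `f` to `[c, d]` is monotone on the whole line.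
  set F : ℝ → ℝ := fun x => f (max c (min d x)) with hF
  have hFmono : Monotone F := fun x y hxy => h.monotoneOn
    (hcd ⟨le_max_left _ _, max_le (hcp.trans hpd).le (min_le_left _ _)⟩)
    (hcd ⟨le_max_left _ _, max_le (hcp.trans hpd).le (min_le_left _ _)⟩) (by gcongr)
  have hFf : ∀ x ∈ Icc c d, F x = f x := fun x hx => by
    simp only [hF, min_eq_right hx.2, max_eq_right hx.1]
  have hcont : ContinuousAt F p := by
    rw [hFmono.continuousAt_iff_leftLim_eq_rightLim]
    refine le_antisymm (hFmono.leftLim_le_rightLim le_rfl) ?_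
    have hright : ∀ m : ℕ, m ≠ 0 →
        Tendsto (fun s : ℝ => p * s ^ m) (𝓝[>] 1) (𝓝[>] p) := fun m hm => by
      refine tendsto_nhdsWithin_iff.2 ⟨?_, ?_⟩
      · have : Tendsto (fun s : ℝ => p * s ^ m) (𝓝 1) (𝓝 (p * 1 ^ m)) :=
          (by fun_prop : Continuous fun s : ℝ => p * s ^ m).tendsto 1
        simp only [one_pow, mul_one] at this
        exact this.mono_left nhdsWithin_le_nhds
      · filter_upwards [self_mem_nhdsWithin] with s hs
        exact lt_mul_of_one_lt_right hp0 (one_lt_pow₀ hs hm)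
    have hleft : Tendsto (fun s : ℝ => p / s ^ 2) (𝓝[>] 1) (𝓝[<] p) := by
      refine tendsto_nhdsWithin_iff.2 ⟨?_, ?_⟩
      · have : Tendsto (fun s : ℝ => p / s ^ 2) (𝓝 1) (𝓝 (p / 1 ^ 2)) :=
          ContinuousAt.div (by fun_prop) (by fun_prop) (by norm_num)
        simp only [one_pow, div_one] at this
        exact this.mono_left nhdsWithin_le_nhds
      · filter_upwards [self_mem_nhdsWithin] with s hs
        exact div_lt_self hp0 (one_lt_pow₀ hs two_ne_zero)
    -- The entries come from `a = 0` and `u = (√p / s, √p s ^ 3)`: for `s > 1` the diagonal ones lie on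
    -- either side of `p`, and the off-diagonal one lies to the right of `p`.
    have hineq : ∀ᶠ s : ℝ in 𝓝[>] 1, F (p * s ^ 2) ^ 2 ≤ F (p / s ^ 2) * F (p * s ^ 6) := by
      filter_upwards [self_mem_nhdsWithin, hleft (Ioo_mem_nhdsLT hcp),
        hright 2 two_ne_zero (Ioo_mem_nhdsGT hpd), hright 6 (by norm_num) (Ioo_mem_nhdsGT hpd)]
        with s hs h1 h2 h6
      have hs0 : (0 : ℝ) < s := zero_lt_one.trans hs
      have m1 : p / s ^ 2 ∈ Icc c d := ⟨h1.1.le, (h1.2.trans hpd).le⟩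
      have m2 : p * s ^ 2 ∈ Icc c d := ⟨(hcp.trans h2.1).le, h2.2.le⟩
      have m6 : p * s ^ 6 ∈ Icc c d := ⟨(hcp.trans h6.1).le, h6.2.le⟩
      rw [hFf _ m1, hFf _ m2, hFf _ m6]
      have hsq : √p ^ 2 = p := Real.sq_sqrt hp0.le
      have e1 : 0 + √p / s * (√p / s) = p / s ^ 2 := by rw [zero_add, ← hsq]; field_simp; simp
      have e2 : 0 + √p / s * (√p * s ^ 3) = p * s ^ 2 := by
        rw [zero_add]; nth_rewrite 3 [← hsq]; field_simp
      have e6 : 0 + √p * s ^ 3 * (√p * s ^ 3) = p * s ^ 6 := by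
        rw [zero_add]; nth_rewrite 3 [← hsq]; ring
      have := h.sq_le (a := 0) (v := √p / s) (w := √p * s ^ 3) le_rfl
        (by rw [e1]; exact hcd m1) (by rw [e2]; exact hcd m2) (by rw [e6]; exact hcd m6)
      rwa [e1, e2, e6] at this
    have hlim := le_of_tendsto_of_tendsto
      (((hFmono.tendsto_rightLim p).comp (hright 2 two_ne_zero)).pow 2)
      (((hFmono.tendsto_leftLim p).comp hleft).mul
        ((hFmono.tendsto_rightLim p).comp (hright 6 (by norm_num)))) hineq
    have hnn : ∀ x, 0 ≤ F x := fun x => h.nonneg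
      (hcd ⟨le_max_left _ _, max_le (hcp.trans hpd).le (min_le_left _ _)⟩)
    have hL : 0 ≤ leftLim F p := ge_of_tendsto (hFmono.tendsto_leftLim p)
      (Eventually.of_forall hnn)
    by_contra! hlt
    nlinarith
  exact (hcont.congr (eventually_of_mem (Icc_mem_nhds hcp hpd) hFf)).continuousWithinAt

end PreservesSpecial

/-! ### Loewner's test for smooth functions -/

section Loewner

open Set Filter Topology Asymptotics

/-- The coefficients of the `k`-th forward difference, as weights on the nodes `0, …, k`. -/
def fwdDiffWeight (k : ℕ) (i : Fin (k + 1)) : ℝ :=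
  (-1) ^ (k - i : ℕ) * (k.choose i : ℝ)

lemma sum_fwdDiffWeight_mul_pow (k m : ℕ) :
    ∑ i, fwdDiffWeight k i * (i : ℝ) ^ m = (fwdDiff (1 : ℝ))^[k] (fun r => r ^ m) 0 := by
  rw [fwdDiff_iter_eq_sum_shift, Finset.sum_range]
  refine Finset.sum_congr rfl fun i _ => ?_
  simp [fwdDiffWeight]

/-- If `G` passes the positivity test for `x 1 + t u uᵀ` for small `t > 0`, its derivatives at `x`
are nonnegative: when `c` annihilates the powers `uᵢ ^ m` with `m < k`, the quadratic form
`∑ cᵢ cⱼ G (x + t uᵢ uⱼ)` is a positive multiple of `G⁽ᵏ⁾(x) t ^ k` up to higher order terms. -/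
lemma iteratedDeriv_nonneg_of_sum_nonneg {G : ℝ → ℝ} {x : ℝ} (hG : ContDiff ℝ ∞ G)
    (h : ∀ n : ℕ, 1 ≤ n → ∀ u c : Fin n → ℝ,
      ∀ᶠ t in 𝓝[>] 0, 0 ≤ ∑ i, ∑ j, c i * c j * G (x + t * (u i * u j))) (k : ℕ) :
    0 ≤ iteratedDeriv k G x := by
  set c := fwdDiffWeight k
  set u : Fin (k + 1) → ℝ := fun i => (i : ℝ)
  have htaylor : (fun y => G y - taylorWithinEval G k univ x y) =o[𝓝 x] fun y => (y - x) ^ k :=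
    taylor_isLittleO_univ (hG.of_le (by exact_mod_cast le_top))
  have hterm : ∀ w : ℝ, (fun t => G (x + t * w) - taylorWithinEval G k univ x (x + t * w))
      =o[𝓝[>] 0] fun t => t ^ k := fun w => by
    have hw : Tendsto (fun t : ℝ => x + t * w) (𝓝[>] 0) (𝓝 x) := by
      have : Tendsto (fun t : ℝ => x + t * w) (𝓝 0) (𝓝 (x + 0 * w)) :=
        (by fun_prop : Continuous fun t : ℝ => x + t * w).tendsto 0
      rw [zero_mul, add_zero] at this
      exact this.mono_left nhdsWithin_le_nhds
    refine (htaylor.comp_tendsto hw).trans_isBigO ?_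
    simp only [Function.comp_def, add_sub_cancel_left, mul_pow]
    simpa only [mul_comm] using isBigO_const_mul_self (w ^ k) (fun t : ℝ => t ^ k) (𝓝[>] 0)
  have hpoly : ∀ t, ∑ i, ∑ j, c i * c j * taylorWithinEval G k univ x (x + t * (u i * u j)) =
      k.factorial * iteratedDeriv k G x * t ^ k := fun t => by
    have hsplit : ∀ i j, c i * c j * taylorWithinEval G k univ x (x + t * (u i * u j)) =
        ∑ m ∈ Finset.range (k + 1), (m.factorial : ℝ)⁻¹ * iteratedDeriv m G x * t ^ m *
          ((c i * u i ^ m) * (c j * u j ^ m)) := fun i j => by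
      rw [taylor_within_apply, Finset.mul_sum]
      refine Finset.sum_congr rfl fun m _ => ?_
      rw [iteratedDerivWithin_univ, add_sub_cancel_left, smul_eq_mul]
      ring
    simp_rw [hsplit]
    -- Bring the sum over `m` outside, where each term is a multiple of a square.
    rw [Finset.sum_congr rfl fun i _ => Finset.sum_comm, Finset.sum_comm]
    have hprod : ∀ m, ∑ i, ∑ j, (m.factorial : ℝ)⁻¹ * iteratedDeriv m G x * t ^ m *
        ((c i * u i ^ m) * (c j * u j ^ m)) = (m.factorial : ℝ)⁻¹ * iteratedDeriv m G x * t ^ m *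
          ((fwdDiff (1 : ℝ))^[k] (fun r => r ^ m) 0) ^ 2 := fun m => by
      rw [← sum_fwdDiffWeight_mul_pow, sq, Finset.sum_mul_sum, Finset.mul_sum]
      exact Finset.sum_congr rfl fun i _ => by rw [Finset.mul_sum]
    rw [Finset.sum_congr rfl fun m _ => hprod m, Finset.sum_range_succ,
      Finset.sum_eq_zero fun m hm => by
        rw [fwdDiff_iter_pow_eq_zero_of_lt (Finset.mem_range.1 hm)]; simp,
      fwdDiff_iter_eq_factorial]
    have : (k.factorial : ℝ) ≠ 0 := by positivity
    simp only [Pi.natCast_apply]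
    field_simp
    ring
  have hsum : (fun t => ∑ i, ∑ j, c i * c j * G (x + t * (u i * u j)) -
      k.factorial * iteratedDeriv k G x * t ^ k) =o[𝓝[>] 0] fun t => t ^ k := by
    have := IsLittleO.sum (s := Finset.univ) fun i _ => IsLittleO.sum (s := Finset.univ)
      fun j _ => (hterm (u i * u j)).const_mul_left (c i * c j)
    refine this.congr_left fun t => ?_
    rw [← hpoly]
    simp only [Finset.sum_apply, mul_sub, Finset.sum_sub_distrib]
  by_contra! hneg
  have hD : (k.factorial : ℝ) * iteratedDeriv k G x < 0 := mul_neg_of_pos_of_neg (by positivity) hneg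
  obtain ⟨t, ht1, ht2, ht3⟩ := ((hsum.def (c := -(k.factorial * iteratedDeriv k G x) / 2)
    (by linarith)).and ((h (k + 1) (by simp) u c).and self_mem_nhdsWithin)).exists
  have htk : 0 < t ^ k := pow_pos ht3 k
  rw [Real.norm_eq_abs, Real.norm_of_nonneg htk.le] at ht1
  nlinarith [(le_abs_self _).trans ht1]

end Loewner

/-! ### Mollification -/

section Mollification

open Set Filter Topology MeasureTheory
open scoped Convolution

lemma sum_convolution_nonneg {F : ℝ → ℝ} (hF : Continuous F) (φ : ContDiffBump (0 : ℝ))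
    {ι : Type*} [Fintype ι] (c y : ι → ℝ)
    (h : ∀ s, |s| < φ.rOut → 0 ≤ ∑ i, c i * F (y i - s)) :
    0 ≤ ∑ i, c i * (φ.normed volume ⋆[ContinuousLinearMap.lsmul ℝ ℝ, volume] F) (y i) := by
  have hint : ∀ i, Integrable (fun s => c i * (φ.normed volume s * F (y i - s))) := fun i =>
    ((φ.continuous_normed.mul (by fun_prop)).integrable_of_hasCompactSupport
      φ.hasCompactSupport_normed.mul_right).const_mul _
  have heq : ∑ i, c i * (φ.normed volume ⋆[ContinuousLinearMap.lsmul ℝ ℝ, volume] F) (y i) =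
      ∫ s, φ.normed volume s * ∑ i, c i * F (y i - s) := by
    simp only [convolution_lsmul, smul_eq_mul, ← integral_const_mul]
    rw [← integral_finsetSum _ fun i _ => hint i]
    congr 1 with s
    rw [Finset.mul_sum]
    exact Finset.sum_congr rfl fun i _ => by ring
  rw [heq]
  refine integral_nonneg fun s => ?_
  by_cases hs : |s| < φ.rOut
  · exact mul_nonneg (φ.nonneg_normed s) (h s hs)
  · have : φ.normed volume s = 0 := by
      rw [← Function.notMem_support, φ.support_normed_eq]
      simpa using hs
    simp [this]

/-- Near each point of `(0, R)`, the function is a limit of its mollifications, whose derivatives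
are nonnegative by Loewner's test. -/
lemma PreservesSpecial.exists_tower {f : ℝ → ℝ} {R : EReal} (h : PreservesSpecial f R) {p : ℝ}
    (hp : p ∈ intervalZeroTo R) :
    ∃ ε > 0, ∃ g, IsDerivTower g (Ioo (p - ε) (p + ε)) ∧ EqOn (g 0) f (Ioo (p - ε) (p + ε)) := by
  obtain ⟨ε, hε, hsub⟩ : ∃ ε > 0, Icc (p - 2 * ε) (p + 2 * ε) ⊆ intervalZeroTo R := by
    obtain ⟨η, hη, hball⟩ := Metric.isOpen_iff.1 isOpen_intervalZeroTo p hp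
    refine ⟨η / 4, by positivity, fun x hx => hball ?_⟩
    rw [Metric.mem_ball, Real.dist_eq, abs_lt]
    constructor <;> linarith [hx.1, hx.2]
  refine ⟨ε, hε, ?_⟩
  -- A continuous function on the line that agrees with `f` on `[p - 2ε, p + 2ε]`.
  set F : ℝ → ℝ := fun x => f (max (p - 2 * ε) (min (p + 2 * ε) x)) with hFdef
  have hF : Continuous F := h.continuousOn.comp_continuous (by fun_prop) fun x =>
    hsub ⟨le_max_left _ _, max_le (by linarith) (min_le_left _ _)⟩
  have hFf : ∀ x ∈ Icc (p - 2 * ε) (p + 2 * ε), F x = f x := fun x hx => by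
    simp only [hFdef, min_eq_right hx.2, max_eq_right hx.1]
  let φ : ℕ → ContDiffBump (0 : ℝ) := fun i =>
    ⟨ε / (i + 2), ε / (i + 1), by positivity, by gcongr; norm_num⟩
  have hφ : ∀ i, (φ i).rOut ≤ ε := fun i => div_le_self hε.le (by simp)
  have hφ0 : Tendsto (fun i => (φ i).rOut) atTop (𝓝 0) := by
    simpa [φ, div_eq_mul_inv] using
      (tendsto_one_div_add_atTop_nhds_zero_nat (𝕜 := ℝ)).const_mul ε
  set G : ℕ → ℝ → ℝ := fun i =>
    (φ i).normed volume ⋆[ContinuousLinearMap.lsmul ℝ ℝ, volume] F with hGdef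
  have hG : ∀ i, ContDiff ℝ ∞ (G i) := fun i =>
    (φ i).hasCompactSupport_normed.contDiff_convolution_left _ (φ i).contDiff_normed
      hF.locallyIntegrable
  refine IsDerivTower.exists_of_tendsto (G := fun i k => iteratedDeriv k (G i)) (fun i => ?_)
    (convex_Ioo _ _) isOpen_Ioo fun x hx => ?_
  · refine IsDerivTower.of_contDiffOn isOpen_Ioo (hG i).contDiffOn fun k x hx => ?_
    refine iteratedDeriv_nonneg_of_sum_nonneg (hG i) (fun n hn u c => ?_) k
    have hxp : |x - p| < ε := by rw [abs_lt]; constructor <;> linarith [hx.1, hx.2]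
    have hsmall : ∀ᶠ t : ℝ in 𝓝[>] 0, ∀ i j, |t * (u i * u j)| < ε - |x - p| := by
      refine eventually_all.2 fun i => eventually_all.2 fun j => nhdsWithin_le_nhds ?_
      have : Tendsto (fun t : ℝ => |t * (u i * u j)|) (𝓝 0) (𝓝 |0 * (u i * u j)|) :=
        (by fun_prop : Continuous fun t : ℝ => |t * (u i * u j)|).tendsto 0
      rw [zero_mul, abs_zero] at this
      exact this.eventually_lt_const (sub_pos.2 hxp)
    filter_upwards [hsmall, self_mem_nhdsWithin] with t ht ht0
    have key := sum_convolution_nonneg hF (φ i) (fun q : Fin n × Fin n => c q.1 * c q.2)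
      (fun q => x + t * (u q.1 * u q.2)) fun s hs => ?_
    · rwa [Fintype.sum_prod_type] at key
    · have hs' := hs.trans_le (hφ i)
      have hmem : ∀ i j, x + t * (u i * u j) - s ∈ Icc (p - 2 * ε) (p + 2 * ε) := fun i j => by
        have h1 := abs_lt.1 hs'
        have h2 := abs_lt.1 (ht i j)
        have h3 := abs_le.1 (le_refl |x - p|)
        constructor <;> linarith
      have hpos : 0 ≤ x - s := by
        have := (hsub ⟨le_rfl, by linarith⟩ : p - 2 * ε ∈ intervalZeroTo R).1
        linarith [hx.1, (abs_lt.1 hs').2]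
      have hroot : ∀ i j, x + t * (u i * u j) - s = (x - s) + √t * u i * (√t * u j) :=
        fun i j => by
          rw [mul_mul_mul_comm, Real.mul_self_sqrt (le_of_lt ht0)]
          ring
      rw [Fintype.sum_prod_type]
      have := h.sum_nonneg hn hpos (fun i => √t * u i) c fun i j => by
        rw [← hroot]; exact hsub (hmem i j)
      refine this.trans_eq (Finset.sum_congr rfl fun i _ => Finset.sum_congr rfl fun j _ => ?_)
      rw [hFf _ (hmem i j), hroot]
  · have := ContDiffBump.convolution_tendsto_right_of_continuous (μ := volume) hφ0 hF x
    rw [hFf x ⟨by linarith [hx.1], by linarith [hx.2]⟩] at this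
    simpa only [iteratedDeriv_zero] using this

lemma PreservesSpecial.isAbsolutelyMonotonicOn {f : ℝ → ℝ} {R : EReal}
    (h : PreservesSpecial f R) : IsAbsolutelyMonotonicOn f (intervalZeroTo R) := by
  rw [IsAbsolutelyMonotonicOn, isOpen_intervalZeroTo.interior_eq]
  refine ⟨h.continuousOn, fun p hp => ?_, fun k p hp => ?_⟩ <;>
    obtain ⟨ε, hε, g, hg, hgf⟩ := h.exists_tower hp <;>
    have hpJ : Ioo (p - ε) (p + ε) ∈ 𝓝 p := Ioo_mem_nhds (by linarith) (by linarith)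
  · refine ((contDiffAt_infty.2 fun n => ?_ : ContDiffAt ℝ ∞ f p)).contDiffWithinAt
    exact (((hg.contDiffOn isOpen_Ioo n 0).congr fun x hx => (hgf hx).symm)).contDiffAt hpJ
  · rw [← (hgf.eventuallyEq_of_mem hpJ).iteratedDeriv_eq,
      hg.iteratedDeriv_eq isOpen_Ioo k (mem_of_mem_nhds hpJ)]
    exact (hg k p (mem_of_mem_nhds hpJ)).2

end Mollification

theorem theoremC (R : EReal) (hR : 0 < R) (f : ℝ → ℝ) :
    List.TFAE [
      ∀ n : ℕ, 1 ≤ n → ∀ a : ℝ, 0 ≤ a → (a : EReal) < R → ∀ u : Fin n → ℝ,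
        (∀ i j, a + u i * u j ∈ intervalZeroTo R) →
          (specialMatrix a u).map f ∈ psdMatrices n Set.univ,
      ∀ n : ℕ, 1 ≤ n → ∀ A ∈ psdMatrices n (intervalZeroTo R),
        A.map f ∈ psdMatrices n Set.univ,
      IsAbsolutelyMonotonicOn f (intervalZeroTo R)] := by
  tfae_have 1 → 3 := fun h => by
    refine PreservesSpecial.isAbsolutelyMonotonicOn fun n hn a ha u hI => ?_
    have haR : (a : EReal) < R := (EReal.coe_le_coe_iff.2
      (le_add_of_nonneg_right (mul_self_nonneg _))).trans_lt (hI ⟨0, hn⟩ ⟨0, hn⟩).2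
    exact (h n hn a ha haR u hI).1
  tfae_have 3 → 2 := fun h n hn A hA => ⟨h.posSemidef_map hn hA.1 hA.2, fun _ _ => trivial⟩
  tfae_have 2 → 1 := fun h n hn a ha _ u hI =>
    h n hn _ ⟨posSemidef_specialMatrix ha u, fun i j => by rw [specialMatrix_apply]; exact hI i j⟩
  tfae_finish
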